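/- For $p\in(0,1)$ let $\mathcal G_{n,p}$ denote the Erdős–Rényi random graph on $n$ labelled vertices, in which each of the $\binom n2$ possible edges is present independently with probability $p$. There is a constant $C>0$ such that, for every $p\in(0,1)$ (not depending on $n$), the following holds. For each sufficiently large $n$ let $d_n$ be the largest integer $d$ such that $d\le pn-C\sqrt{n\log n}$ and $nd$ is even, that is, $pn-C\sqrt{n\log n}$ rounded down to an integer for which a $d$-regular graph on $n$ vertices can have $nd/2$ edges. Then $$\Pr_{G\sim\mathcal G_{n,p}}\big[\,G\text{ has a }d_n\text{-regular subgraph on the same vertex set}\,\big]\longrightarrow 1\qquad(n\to\infty).$$ -/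

import Mathlib

/-- `G` contains a spanning `d`-regular subgraph: a `d`-regular graph on the same vertex set, all
of whose edges are edges of `G`. -/
def HasSpanningRegularSubgraph {V : Type*} [Fintype V] (G : SimpleGraph V) (d : ℕ) : Prop :=
  ∃ (H : SimpleGraph V) (_ : DecidableRel H.Adj), H ≤ G ∧ H.IsRegularOfDegree d

/-- The number `p n - C √(n log n)`, rounded down to the nearest integer `d` for which `n d` is
even (a `d`-regular graph on `n` vertices has `n d / 2` edges). Negative numbers are sent to `0`;
for fixed `C` and `p > 0` this concerns finitely many `n` only. -/
noncomputable def regDegree (C p : ℝ) (n : ℕ) : ℕ :=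
  if Even (n * ⌊p * n - C * √(n * Real.log n)⌋₊) then ⌊p * n - C * √(n * Real.log n)⌋₊
  else ⌊p * n - C * √(n * Real.log n)⌋₊ - 1

/-- `regDegree` is the rounding described above. -/
theorem regDegree_isGreatest {C p : ℝ} {n : ℕ} (h : 0 ≤ p * n - C * √(n * Real.log n)) :
    IsGreatest {d : ℕ | (d : ℝ) ≤ p * n - C * √(n * Real.log n) ∧ Even (n * d)}
      (regDegree C p n) := by
  unfold regDegree
  set x := p * n - C * √(n * Real.log n)
  have hx : (⌊x⌋₊ : ℝ) ≤ x := Nat.floor_le h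
  split_ifs with he
  · exact ⟨⟨hx, he⟩, fun d hd => Nat.le_floor hd.1⟩
  · have ho : Odd n ∧ Odd ⌊x⌋₊ := by
      rw [← Nat.odd_mul]
      exact Nat.not_even_iff_odd.mp he
    refine ⟨⟨le_trans (by exact_mod_cast Nat.sub_le _ _) hx, ?_⟩, fun d hd => ?_⟩
    · exact (Nat.Odd.sub_odd ho.2 odd_one).mul_left n
    · have h1 : d ≤ ⌊x⌋₊ := Nat.le_floor hd.1
      have h2 : d ≠ ⌊x⌋₊ := fun h3 => he (h3 ▸ hd.2)
      lia

/-! Take a largest edge set `E` of `G` with all degrees at most `d`. If `E` is not `d`-regular,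
parity of `n d` makes the total deficiency at least two, so some `u`, `v` (possibly equal) can each
absorb one more edge. By maximality there is no alternating walk from `u` to `v` with distinct edges
that starts and ends outside `E`. Walks of length 1, 3 and 5 suffice for a contradiction
(`hasSpanningRegularSubgraph_of_expansion`).

Call edges of `G` outside `E` residual. A vertex of full `E`-degree has few residual edges, whereas
`G` has many edges between moderately large sets. Hence the residual neighbours of `u` reach all but
few vertices along `E`, and nearly every vertex has a residual neighbour among those reached. A
vertex `y` residually adjacent to `v` has so many `E`-neighbours that one of them closes a walk of
length 5.

In the random graph put `s = √(n log n)`. Hoeffding's inequality and union bounds give, with high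
probability, degrees within `s` of `p (n - 1)` and at least half the expected edges between disjoint
sets of sizes about `s` and `14 s / p` (`binomialRandom_not_isTypical_le`). Choosing `d` about `p n
- 4 s` then leaves residual degrees of order `s`, as the deterministic argument needs. -/

section Deterministic

/-! ### Maximal edge sets of bounded degree and alternating walks. -/

open Finset Classical

variable {V : Type*}

/-- The number of members of the edge set `E` that contain the vertex `w`. -/
noncomputable def incDeg (E : Finset (Sym2 V)) (w : V) : ℕ := #{e ∈ E | w ∈ e}

theorem incDeg_insert {E : Finset (Sym2 V)} {x y : V} (hxy : x ≠ y) (h : s(x, y) ∉ E) (w : V) :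
    incDeg (insert s(x, y) E) w
      = (if w = x then 1 else 0) + (if w = y then 1 else 0) + incDeg E w := by
  unfold incDeg
  rw [filter_insert]
  by_cases hx : w = x
  · subst hx
    have : s(w, y) ∉ E.filter (w ∈ ·) := fun h' => h (mem_filter.1 h').1
    simp [card_insert_of_notMem this, hxy, add_comm]
  · by_cases hy : w = y
    · subst hy
      have : s(x, w) ∉ E.filter (w ∈ ·) := fun h' => h (mem_filter.1 h').1
      simp [card_insert_of_notMem this, hx, add_comm]
    · simp [hx, hy]

@[simp] theorem incDeg_empty (w : V) : incDeg (∅ : Finset (Sym2 V)) w = 0 := by simp [incDeg]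

variable [Fintype V]

theorem incDeg_eq_card_nbr {E : Finset (Sym2 V)} (w : V) :
    incDeg E w = #{y : V | s(w, y) ∈ E} := by
  unfold incDeg
  symm
  apply card_bij (fun y _ => s(w, y))
  · simp
  · intro a _ b _ h
    exact Sym2.congr_right.1 h
  · intro e he
    obtain ⟨he, hw⟩ := mem_filter.1 he
    obtain ⟨y, rfl⟩ := Sym2.mem_iff_exists.1 hw
    exact ⟨y, by simpa using he, rfl⟩

theorem sum_incDeg {E : Finset (Sym2 V)} (hE : ∀ e ∈ E, ¬ e.IsDiag) :
    ∑ w, incDeg E w = 2 * #E := by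
  unfold incDeg
  simp_rw [card_filter]
  rw [sum_comm, mul_comm, ← smul_eq_mul, ← sum_const]
  refine sum_congr rfl fun e he => ?_
  rw [← card_filter, ← Sym2.card_toFinset_of_not_isDiag e (hE e he)]
  congr 1
  ext w
  simp

/-- The graph `G` contains a largest edge set all of whose degrees are at most `d`. -/
theorem exists_max_edges (G : SimpleGraph V) (d : ℕ) :
    ∃ E ⊆ G.edgeFinset, (∀ w, incDeg E w ≤ d) ∧
      ∀ F ⊆ G.edgeFinset, (∀ w, incDeg F w ≤ d) → #F ≤ #E := by
  obtain ⟨E, hE, hmax⟩ := exists_max_image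
    (G.edgeFinset.powerset.filter fun F => ∀ w, incDeg F w ≤ d) card
    ⟨∅, by simp⟩
  simp only [mem_filter, mem_powerset] at hE hmax
  exact ⟨E, hE.1, hE.2, fun F h1 h2 => hmax F ⟨h1, h2⟩⟩

/-- The degrees of `E` can be raised by one at `u` and by one at `v` (by two if `u = v`) without
exceeding `d`. -/
def IsDeficientPair (E : Finset (Sym2 V)) (d : ℕ) (u v : V) : Prop :=
  ∀ w, incDeg E w + (if w = u then 1 else 0) + (if w = v then 1 else 0) ≤ d

/-- If `v` lacked exactly one edge and every other vertex were full, the degree sum would be `n d -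
1`, which is odd. So either `v` lacks two or another vertex is deficient. -/
theorem exists_isDeficientPair {E : Finset (Sym2 V)} (hE : ∀ e ∈ E, ¬ e.IsDiag) {d : ℕ}
    (hd : ∀ w, incDeg E w ≤ d) (hev : Even (Fintype.card V * d)) {v : V} (hv : incDeg E v < d) :
    ∃ u, IsDeficientPair E d u v := by
  by_cases h2 : incDeg E v + 2 ≤ d
  · refine ⟨v, fun w => ?_⟩
    have := hd w
    by_cases h : w = v
    · subst h; simp; omega
    · simpa [h]
  by_cases h : ∃ u, u ≠ v ∧ incDeg E u < d
  · obtain ⟨u, huv, hu⟩ := h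
    refine ⟨u, fun w => ?_⟩
    have := hd w
    by_cases h : w = v
    · subst h; simp [huv.symm]; omega
    · by_cases h' : w = u
      · subst h'; simp [huv]; omega
      · simpa [h, h']
  push Not at h
  exfalso
  have h3 : ∑ w, (incDeg E w + if w = v then 1 else 0) = ∑ _w : V, d := by
    refine sum_congr rfl fun w _ => ?_
    by_cases hw : w = v
    · subst hw; simp; omega
    · simp [hw]; exact le_antisymm (hd w) (h w hw)
  rw [sum_add_distrib, sum_incDeg hE] at h3
  simp at h3
  rw [← h3] at hev
  exact absurd hev (by simp [parity_simps])

/-- The augmentation principle: exchanging `N` for `P` changes degrees only at `u` and `v`, where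
there is room, and enlarges `E`. -/
theorem IsDeficientPair.not_augment {G : SimpleGraph V} {E : Finset (Sym2 V)} {d : ℕ}
    (hE : E ⊆ G.edgeFinset)
    (hmax : ∀ F ⊆ G.edgeFinset, (∀ w, incDeg F w ≤ d) → #F ≤ #E)
    {u v : V} (huv : IsDeficientPair E d u v) {P N : Finset (Sym2 V)}
    (hP : P ⊆ G.edgeFinset) (hPE : Disjoint P E) (hN : N ⊆ E) (hc : #N < #P)
    (hdeg : ∀ w, incDeg P w
      = incDeg N w + ((if w = u then 1 else 0) + (if w = v then 1 else 0))) : False := by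
  have hd : Disjoint P (E \ N) := hPE.mono_right sdiff_subset
  have h1 := hmax (P ∪ (E \ N)) (union_subset hP (sdiff_subset.trans hE)) fun w => by
    have h2 : incDeg (P ∪ (E \ N)) w = incDeg P w + incDeg (E \ N) w := by
      unfold incDeg
      rw [filter_union, card_union_of_disjoint (disjoint_filter_filter hd)]
    have h3 : incDeg (E \ N) w + incDeg N w = incDeg E w := by
      unfold incDeg
      rw [← card_union_of_disjoint (disjoint_filter_filter sdiff_disjoint), ← filter_union,
        sdiff_union_of_subset hN]
    have := huv w
    have := hdeg w
    omega
  rw [card_union_of_disjoint hd, card_sdiff_of_subset hN] at h1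
  have := card_le_card hN
  omega

section Augment

variable {G : SimpleGraph V} {E : Finset (Sym2 V)} {d : ℕ}
  (hE : E ⊆ G.edgeFinset)
  (hmax : ∀ F ⊆ G.edgeFinset, (∀ w, incDeg F w ≤ d) → #F ≤ #E)
  {u v : V} (huv : IsDeficientPair E d u v)

include hE hmax huv

theorem IsDeficientPair.not_adj (h : G.Adj u v) : s(u, v) ∈ E := by
  by_contra h'
  refine huv.not_augment hE hmax (P := {s(u, v)}) (N := ∅) (by simpa using h) (by simpa using h')
    (by simp) (by simp) fun w => ?_
  rw [← insert_empty, incDeg_insert h.ne (by simp)]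
  simp

theorem IsDeficientPair.not_path_three {a b : V} (hua : G.Adj u a) (hua' : s(u, a) ∉ E)
    (hvb : G.Adj v b) (hvb' : s(v, b) ∉ E) : s(a, b) ∉ E := by
  intro hab
  have hab' : a ≠ b := (by simpa using hE hab : G.Adj a b).ne
  have hne : s(u, a) ≠ s(v, b) := by
    intro h
    rcases Sym2.eq_iff.1 h with ⟨rfl, h2⟩ | ⟨rfl, rfl⟩
    · exact hab' h2
    · exact hua' (Sym2.eq_swap ▸ hab)
  refine huv.not_augment hE hmax (P := {s(u, a), s(v, b)}) (N := {s(a, b)}) ?_ ?_ ?_ ?_ fun w => ?_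
  · simp [insert_subset_iff, hua, hvb]
  · simp [hua', hvb']
  · simpa using hab
  · simp [card_pair hne]
  · rw [incDeg_insert hua.ne (by simpa using hne), ← insert_empty (a := s(v, b)), ← insert_empty (a := s(a, b)),
      incDeg_insert hvb.ne (by simp), incDeg_insert hab' (by simp)]
    simp only [incDeg_empty]
    ring

/-- The walk `u a x b y v` may repeat vertices. The four inequalities serve only to keep its edges
distinct, so that three are added and two removed. -/
theorem IsDeficientPair.not_path_five {a x b y : V} (hua : G.Adj u a) (hua' : s(u, a) ∉ E)
    (hax : s(a, x) ∈ E) (hxb : G.Adj x b) (hxb' : s(x, b) ∉ E) (hby : s(b, y) ∈ E)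
    (hyv : G.Adj y v) (hyv' : s(y, v) ∉ E) (hav : a ≠ v) (hay : a ≠ y) (hbu : b ≠ u)
    (hbv : b ≠ v) : False := by
  have hax' : G.Adj a x := by simpa using hE hax
  have hby' : G.Adj b y := by simpa using hE hby
  have h1 : s(u, a) ≠ s(x, b) := by
    intro h
    rcases Sym2.eq_iff.1 h with ⟨rfl, h2⟩ | ⟨h2, _⟩
    · exact hua' (Sym2.eq_swap ▸ hax)
    · exact hbu h2.symm
  have h2 : s(u, a) ≠ s(y, v) := by
    intro h
    rcases Sym2.eq_iff.1 h with ⟨_, h2⟩ | ⟨_, h2⟩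
    · exact hav h2
    · exact hay h2
  have h3 : s(x, b) ≠ s(y, v) := by
    intro h
    rcases Sym2.eq_iff.1 h with ⟨_, h2⟩ | ⟨_, h2⟩
    · exact hbv h2
    · exact hby'.ne h2
  have h4 : s(a, x) ≠ s(b, y) := by
    intro h
    rcases Sym2.eq_iff.1 h with ⟨h2, h5⟩ | ⟨_, h2⟩
    · subst h2
      subst h5
      exact hxb' (Sym2.eq_swap ▸ hax)
    · exact hxb.ne h2
  refine huv.not_augment hE hmax (P := {s(u, a), s(x, b), s(y, v)}) (N := {s(a, x), s(b, y)})
    ?_ ?_ ?_ ?_ fun w => ?_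
  · simp [insert_subset_iff, hua, hxb, hyv]
  · simp [hua', hxb', hyv']
  · simp [insert_subset_iff, hax, hby]
  · rw [card_pair h4, card_insert_of_notMem (by simp [h1, h2]), card_pair h3]
    simp
  · rw [incDeg_insert hua.ne (by simp [h1, h2]), incDeg_insert hxb.ne (by simpa using h3),
      ← insert_empty (a := s(y, v)), ← insert_empty (a := s(b, y)), incDeg_insert hyv.ne (by simp),
      incDeg_insert hax'.ne (by simpa using h4), incDeg_insert hby'.ne (by simp)]
    simp only [incDeg_empty]
    ring

end Augment

/-! ### The residual graph and expansion. -/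

/-- The neighbours of `x` along edges of `G` outside `E`. -/
noncomputable def resNbr (G : SimpleGraph V) (E : Finset (Sym2 V)) (x : V) : Finset V :=
  {y | G.Adj x y ∧ s(x, y) ∉ E}

theorem mem_resNbr {G : SimpleGraph V} {E : Finset (Sym2 V)} {x y : V} :
    y ∈ resNbr G E x ↔ G.Adj x y ∧ s(x, y) ∉ E := by simp [resNbr]

theorem mem_resNbr_comm {G : SimpleGraph V} {E : Finset (Sym2 V)} {x y : V} :
    y ∈ resNbr G E x ↔ x ∈ resNbr G E y := by
  rw [mem_resNbr, mem_resNbr, G.adj_comm, Sym2.eq_swap]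

theorem card_resNbr_add_incDeg {G : SimpleGraph V} {E : Finset (Sym2 V)} (hE : E ⊆ G.edgeFinset)
    (x : V) : #(resNbr G E x) + incDeg E x = G.degree x := by
  rw [incDeg_eq_card_nbr, ← G.card_neighborFinset_eq_degree,
    ← card_filter_add_card_filter_not (s := G.neighborFinset x) (fun y => s(x, y) ∈ E), add_comm]
  congr 2
  · ext y
    simp only [mem_filter, mem_univ, true_and, SimpleGraph.mem_neighborFinset]
    exact ⟨fun h => ⟨by simpa using hE h, h⟩, fun h => h.2⟩
  · ext y
    simp [mem_resNbr]

/-- Between a vertex set of size `k` and a set that it does not meet along `E`, all edges are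
outside `E`, so expansion bounds the size of the latter. -/
theorem card_lt_of_no_edges {G : SimpleGraph V} {E : Finset (Sym2 V)} {D k M : ℕ}
    (hexp : ∀ A B : Finset V, #A = k → M ≤ #B → D * k < ∑ a ∈ A, #{b ∈ B | G.Adj a b})
    {A B : Finset V} (hA : k ≤ #A) (hD : ∀ a ∈ A, #(resNbr G E a) ≤ D)
    (hAB : ∀ a ∈ A, ∀ b ∈ B, s(a, b) ∉ E) : #B < M := by
  by_contra! hB
  obtain ⟨A', hA', hk⟩ := exists_subset_card_eq hA
  have h1 := hexp A' B hk hB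
  have h2 : ∑ a ∈ A', #{b ∈ B | G.Adj a b} ≤ ∑ a ∈ A', D := by
    refine sum_le_sum fun a ha => (card_le_card fun b hb => ?_).trans (hD a (hA' ha))
    obtain ⟨hb, hab⟩ := mem_filter.1 hb
    exact mem_resNbr.2 ⟨hab, hAB a (hA' ha) b hb⟩
  rw [sum_const, smul_eq_mul, hk, mul_comm] at h2
  omega

/-- A graph whose degrees exceed `d` slightly, and which has many edges between any two sets that
are not too small, has a spanning `d`-regular subgraph. -/
theorem hasSpanningRegularSubgraph_of_expansion (G : SimpleGraph V) {d r D k M q : ℕ}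
    (hev : Even (Fintype.card V * d))
    (hlo : ∀ x, d + r ≤ G.degree x) (hhi : ∀ x, G.degree x ≤ d + D)
    (hexp : ∀ A B : Finset V, #A = k → M ≤ #B → D * k < ∑ a ∈ A, #{b ∈ B | G.Adj a b})
    (hkr : k + 2 ≤ r) (hDM : D ≤ M) (hq : M * M < q * r) (hqd : q + 3 + M ≤ d) :
    HasSpanningRegularSubgraph G d := by
  obtain ⟨E, hE, hd, hmax⟩ := exists_max_edges G d
  have hdiag : ∀ e ∈ E, ¬ e.IsDiag := fun e he =>
    G.not_isDiag_of_mem_edgeSet (by simpa using hE he)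
  by_cases hreg : ∀ w, incDeg E w = d
  · refine ⟨SimpleGraph.fromEdgeSet (E : Set (Sym2 V)), inferInstance, ?_, fun w => ?_⟩
    · rw [SimpleGraph.fromEdgeSet_le]
      exact fun e he => by simpa using hE he.1
    · rw [← hreg w, incDeg_eq_card_nbr, ← SimpleGraph.card_neighborFinset_eq_degree]
      congr 1
      ext y
      simp only [SimpleGraph.mem_neighborFinset, SimpleGraph.fromEdgeSet_adj, mem_coe, mem_filter,
        mem_univ, true_and, and_iff_left_iff_imp]
      intro h hwy
      exact hdiag _ h (by simpa using hwy)
  exfalso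
  push Not at hreg
  obtain ⟨v, hv⟩ := hreg
  have hv : incDeg E v < d := lt_of_le_of_ne (hd v) hv
  have hrlo : ∀ x, r ≤ #(resNbr G E x) := fun x => by
    have := card_resNbr_add_incDeg hE x
    have := hlo x
    have := hd x
    omega
  have hfull : ∀ x, incDeg E x = d → #(resNbr G E x) ≤ D := fun x hx => by
    have := card_resNbr_add_incDeg hE x
    have := hhi x
    omega
  have hnb : ∀ {x a}, incDeg E x < d → a ∈ resNbr G E x → incDeg E a = d := by
    intro x a hx ha
    rw [mem_resNbr] at ha
    by_contra h
    have h : incDeg E a < d := lt_of_le_of_ne (hd a) h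
    refine ha.2 (IsDeficientPair.not_adj hE hmax (fun w => ?_) ha.1)
    have := hd w
    have := ha.1.ne
    by_cases h1 : w = x
    · subst h1; simp [this]; omega
    · by_cases h2 : w = a
      · subst h2; simp [h1]; omega
      · simpa [h1, h2]
  have hdef : ∀ {u w}, IsDeficientPair E d u w → incDeg E u < d := fun {u w} h => by
    have := h u
    simp at this
    omega
  -- A deficient `x` has a partner `u`. No walk of length 3 means no `E`-edge joins their residual
  -- neighbourhoods, and that of `u` consists of full vertices, so expansion applies.
  have hrhi : ∀ x, #(resNbr G E x) ≤ M := by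
    intro x
    rcases (hd x).eq_or_lt with hx | hx
    · exact (hfull x hx).trans hDM
    · obtain ⟨u, hu⟩ := exists_isDeficientPair hdiag hd hev hx
      refine (card_lt_of_no_edges hexp (A := resNbr G E u) (E := E)
        (by have := hrlo u; omega) (fun a ha => hfull a (hnb (hdef hu) ha)) ?_).le
      intro a ha b hb
      rw [mem_resNbr] at ha hb
      exact hu.not_path_three hE hmax ha.1 ha.2 hb.1 hb.2
  obtain ⟨u, hu⟩ := exists_isDeficientPair hdiag hd hev hv
  obtain ⟨y, hy⟩ : (resNbr G E v).Nonempty := card_pos.1 (by have := hrlo v; omega)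
  -- Deleting `v` and `y` secures `a ≠ v` and `a ≠ y` later; it is the reason for the `2` in `k + 2
  -- ≤ r`.
  set A := resNbr G E u \ {v, y} with hA
  have hAcard : k ≤ #A := by
    have h1 : #(resNbr G E u) - #({v, y} : Finset V) ≤ #A := le_card_sdiff _ _
    have h2 := hrlo u
    have h3 : #({v, y} : Finset V) ≤ 2 := card_le_two
    omega
  set Y : Finset V := {x | ∀ a ∈ A, s(a, x) ∉ E} with hY
  have hYcard : #Y < M := by
    refine card_lt_of_no_edges hexp hAcard
      (fun a ha => hfull a (hnb (hdef hu) (mem_sdiff.1 ha).1)) fun a ha b hb => ?_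
    exact (mem_filter.1 hb).2 a ha
  set Z : Finset V := {b | resNbr G E b ⊆ Y} with hZ
  -- Double count residual edges between `Z` and `Y`: at least `r` at each vertex of `Z`, at most
  -- `M` at each vertex of `Y`.
  have hZcard : #Z < q := by
    have h1 : #Z * r ≤ #Y * M := by
      refine card_mul_le_card_mul (fun b x => x ∈ resNbr G E b) (fun b hb => ?_) fun x hx => ?_
      · refine (hrlo b).trans (card_le_card fun x hx => ?_)
        exact mem_filter.2 ⟨(mem_filter.1 hb).2 hx, hx⟩
      · refine (card_le_card fun b hb => ?_).trans (hrhi x)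
        exact mem_resNbr_comm.1 (mem_filter.1 hb).2
    have h2 : #Y * M ≤ M * M := Nat.mul_le_mul_right _ hYcard.le
    exact lt_of_mul_lt_mul_right (h1.trans_lt (h2.trans_lt hq)) (Nat.zero_le r)
  -- The `E`-degree of `y` is at least `d + r - M`, exceeding the fewer than `q + 3` forbidden
  -- vertices.
  obtain ⟨b, hb, hb'⟩ : ∃ b ∈ ({b | s(y, b) ∈ E} : Finset V), b ∉ Z ∪ {u, v, y} := by
    apply exists_mem_notMem_of_card_lt_card
    rw [← incDeg_eq_card_nbr]
    have h1 := card_resNbr_add_incDeg hE y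
    have h2 := hrhi y
    have h3 := hlo y
    have h4 := card_union_le Z {u, v, y}
    have h5 : #({u, v, y} : Finset V) ≤ 3 := card_le_three
    omega
  simp only [mem_union, mem_insert, mem_singleton, not_or] at hb'
  obtain ⟨hbZ, hbu, hbv, -⟩ := hb'
  rw [hZ, mem_filter, not_and] at hbZ
  obtain ⟨x, hx, hxY⟩ := not_subset.1 (hbZ (mem_univ _))
  rw [hY, mem_filter, not_and] at hxY
  have hxY := hxY (mem_univ _)
  push Not at hxY
  obtain ⟨a, ha, hax⟩ := hxY
  rw [hA, mem_sdiff, mem_resNbr] at ha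
  simp only [mem_insert, mem_singleton, not_or] at ha
  rw [mem_resNbr_comm, mem_resNbr] at hx
  rw [mem_resNbr_comm, mem_resNbr] at hy
  exact hu.not_path_five hE hmax ha.1.1 ha.1.2 hax hx.1 hx.2
    (by rw [Sym2.eq_swap]; simpa using hb) hy.1 hy.2 ha.2.1 ha.2.2 hbu hbv

end Deterministic

/-! ### Hoeffding tails for edge counts. -/

section RandomGraph

open MeasureTheory ProbabilityTheory unitInterval Finset

variable {V : Type*} [Fintype V]

/-- Hoeffding's inequality for a sum over finitely many potential edges of a binomial random
graph, each contributing `g` of its presence. -/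
theorem binomialRandom_sum_ge_le (p : I) (F : Finset (Sym2 V)) (hF : ∀ e ∈ F, ¬ e.IsDiag)
    (g : Prop → ℝ) {a : ℝ} (hg : ∀ P, g P ∈ Set.Icc a (a + 1)) {ε : ℝ} (hε : 0 ≤ ε) :
    (SimpleGraph.binomialRandom V p).real
      {G | ε ≤ ∑ e ∈ F, (g (e ∈ G.edgeSet) - (p * g True + (1 - p) * g False))}
      ≤ Real.exp (-2 * ε ^ 2 / #F) := by
  set m : ℝ := p * g True + (1 - p) * g False with hm
  let ν : Sym2 V → Measure Prop := fun e =>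
    toNNReal p • Measure.dirac (e ∈ (Sym2.diagSetᶜ : Set (Sym2 V)))
      + toNNReal (σ p) • Measure.dirac False
  have hν : ∀ e, IsProbabilityMeasure (ν e) := fun e => by
    constructor
    simp [ν]
  let μ := Measure.infinitePi ν
  have hgm : Measurable g := measurable_from_top
  have hmeasG : ∀ e : Sym2 V, Measurable fun G : SimpleGraph V => g (e ∈ G.edgeSet) := fun e =>
    hgm.comp ((measurable_set_mem e).comp SimpleGraph.measurable_edgeSet)
  have hS : MeasurableSet {G : SimpleGraph V | ε ≤ ∑ e ∈ F, (g (e ∈ G.edgeSet) - m)} :=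
    measurableSet_le measurable_const
      (Finset.measurable_sum _ fun e _ => (hmeasG e).sub_const m)
  -- Passing to the product measure makes the edge indicators independent coordinates.
  have hmap : SimpleGraph.binomialRandom V p
      = μ.map (fun f : Sym2 V → Prop => SimpleGraph.fromEdgeSet {e | f e}) := by
    rw [SimpleGraph.binomialRandom_eq_map, setBernoulli_eq_map, Measure.map_map]
    · rfl
    · fun_prop
    · exact measurable_set_iff.2 fun e => measurable_pi_apply e
  have hΦ : Measurable (fun f : Sym2 V → Prop => SimpleGraph.fromEdgeSet {e | f e}) :=
    SimpleGraph.measurable_fromEdgeSet.comp (measurable_set_iff.2 fun e => measurable_pi_apply e)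
  have hind : iIndepFun (fun (e : Sym2 V) (f : Sym2 V → Prop) => g (f e) - m) μ :=
    iIndepFun_infinitePi (P := ν) (X := fun _ P => g P - m) fun e => hgm.sub_const m
  -- The range of `g` lies in an interval of length one, so Hoeffding's lemma gives the parameter
  -- `(1 / 2) ^ 2`.
  have hsub : ∀ e ∈ F, HasSubgaussianMGF (fun f : Sym2 V → Prop => g (f e) - m) (1 / 4) μ := by
    intro e he
    have hint : ∫ f, g (f e) ∂μ = m := by
      have h1 := (measurePreserving_eval_infinitePi ν e)
      have h2 : ∫ f, g (f e) ∂μ = ∫ P, g P ∂(ν e) := by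
        rw [← h1.map_eq, integral_map h1.measurable.aemeasurable
          hgm.aestronglyMeasurable]
      have h3 : (e ∈ (Sym2.diagSetᶜ : Set (Sym2 V))) = True := by simpa using hF e he
      rw [h2]
      simp only [ν]
      rw [integral_add_measure, integral_smul_nnreal_measure, integral_smul_nnreal_measure,
        integral_dirac, integral_dirac, h3]
      · simp [hm, NNReal.smul_def]
      all_goals exact (integrable_dirac (by simp)).smul_measure_nnreal
    have h := hasSubgaussianMGF_of_mem_Icc (μ := μ) (X := fun f : Sym2 V → Prop => g (f e))
      (hgm.comp (measurable_pi_apply e)).aemeasurable (.of_forall fun f => hg (f e))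
    rw [hint] at h
    convert h using 1
    simp
    norm_num
  have key := HasSubgaussianMGF.measure_sum_ge_le_of_iIndepFun hind hsub hε
  have heq : (SimpleGraph.binomialRandom V p).real
      {G | ε ≤ ∑ e ∈ F, (g (e ∈ G.edgeSet) - m)} = μ.real {f | ε ≤ ∑ e ∈ F, (g (f e) - m)} := by
    rw [hmap, map_measureReal_apply hΦ hS]
    congr 1
    ext f
    simp only [Set.mem_preimage, Set.mem_ofPred_eq]
    refine iff_of_eq (congrArg _ (sum_congr rfl fun e he => ?_))
    congr 2
    simp [hF e he]
  rw [heq]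
  refine key.trans_eq ?_
  congr 1
  simp
  by_cases h0 : (#F : ℝ) = 0
  · simp [h0]
  · field_simp
    norm_num

open Classical in
theorem binomialRandom_card_ge_le (p : I) (F : Finset (Sym2 V)) (hF : ∀ e ∈ F, ¬ e.IsDiag)
    {ε : ℝ} (hε : 0 ≤ ε) :
    (SimpleGraph.binomialRandom V p).real
      {G | (p : ℝ) * #F + ε ≤ #{e ∈ F | e ∈ G.edgeSet}} ≤ Real.exp (-2 * ε ^ 2 / #F) := by
  refine le_trans (le_of_eq ?_) (binomialRandom_sum_ge_le p F hF (fun P => if P then 1 else 0)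
    (a := 0) (fun P => by by_cases h : P <;> simp [h]) hε)
  congr 1
  ext G
  have h : (#{e ∈ F | e ∈ G.edgeSet} : ℝ)
      = ∑ e ∈ F, (fun P : Prop => if P then (1 : ℝ) else 0) (e ∈ G.edgeSet) := by
    rw [natCast_card_filter]
    exact sum_congr rfl fun e _ => by congr
  simp only [Set.mem_ofPred_eq, sum_sub_distrib, sum_const, nsmul_eq_mul, if_true, if_false, h]
  constructor <;> intro h <;> linarith

open Classical in
theorem binomialRandom_card_le_le (p : I) (F : Finset (Sym2 V)) (hF : ∀ e ∈ F, ¬ e.IsDiag)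
    {ε : ℝ} (hε : 0 ≤ ε) :
    (SimpleGraph.binomialRandom V p).real
      {G | (#{e ∈ F | e ∈ G.edgeSet} : ℝ) ≤ p * #F - ε} ≤ Real.exp (-2 * ε ^ 2 / #F) := by
  refine le_trans (le_of_eq ?_) (binomialRandom_sum_ge_le p F hF (fun P => -if P then 1 else 0)
    (a := -1) (fun P => by by_cases h : P <;> simp [h]) hε)
  congr 1
  ext G
  have h : (#{e ∈ F | e ∈ G.edgeSet} : ℝ)
      = ∑ e ∈ F, (fun P : Prop => if P then (1 : ℝ) else 0) (e ∈ G.edgeSet) := by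
    rw [natCast_card_filter]
    exact sum_congr rfl fun e _ => by congr
  simp only [Set.mem_ofPred_eq, sum_sub_distrib, sum_const, nsmul_eq_mul, sum_neg_distrib,
    if_true, if_false, h]
  constructor <;> intro h <;> linarith

end RandomGraph

/-! ### Typical graphs and the choice of parameters. -/

section RandomGraph

open MeasureTheory ProbabilityTheory unitInterval Finset Classical

variable {V : Type*}

theorem injOn_mk_product {A B : Finset V} (hAB : Disjoint A B) :
    Set.InjOn (fun x : V × V => s(x.1, x.2)) (A ×ˢ B : Finset (V × V)) := by
  rintro ⟨a, b⟩ h1 ⟨a', b'⟩ h2 h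
  simp only [coe_product, Set.mem_prod, mem_coe] at h1 h2
  rcases Sym2.eq_iff.1 h with ⟨h3, h4⟩ | ⟨h3, _⟩
  · simp only at h3 h4
    rw [h3, h4]
  · simp only at h3
    exact absurd (h3 ▸ h1.1) (disjoint_right.1 hAB h2.2)

theorem card_cut_filter (G : SimpleGraph V) {A B : Finset V} (hAB : Disjoint A B) :
    #{e ∈ (A ×ˢ B).image (fun x : V × V => s(x.1, x.2)) | e ∈ G.edgeSet}
      = ∑ a ∈ A, #{b ∈ B | G.Adj a b} := by
  rw [filter_image, card_image_of_injOn ((injOn_mk_product hAB).mono (by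
    exact_mod_cast filter_subset _ _))]
  simp only [card_filter, sum_product, SimpleGraph.mem_edgeSet]

variable [Fintype V]

/-- All degrees of `G` are within `s` of `p (n - 1)`, and any two disjoint vertex sets of sizes `k`
and `m` have more than half the expected number of edges between them. -/
def IsTypical (G : SimpleGraph V) (p s : ℝ) (k m : ℕ) : Prop :=
  (∀ v, G.degree v < p * (Fintype.card V - 1) + s) ∧
  (∀ v, p * (Fintype.card V - 1) - s < G.degree v) ∧
  ∀ A B : Finset V, Disjoint A B → #A = k → #B = m →
    p / 2 * (k * m) < ∑ a ∈ A, #{b ∈ B | G.Adj a b}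

theorem card_incidenceFinset_top_filter (G : SimpleGraph V) (v : V) :
    #{e ∈ (⊤ : SimpleGraph V).incidenceFinset v | e ∈ G.edgeSet} = G.degree v := by
  rw [← G.card_incidenceFinset_eq_degree]
  congr 1
  ext e
  simp only [mem_filter, SimpleGraph.mem_incidenceFinset, SimpleGraph.incidenceSet,
    Set.mem_ofPred_eq]
  constructor
  · exact fun h => ⟨h.2, h.1.2⟩
  · exact fun h => ⟨⟨SimpleGraph.edgeSet_mono le_top h.1, h.2⟩, h.1⟩

/-- A union bound over two tails per vertex and at most `4 ^ n` pairs of sets. A cut has `k m`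
potential edges and deviation `p k m / 2`, whence its exponent. -/
theorem binomialRandom_not_isTypical_le (p : I) {s : ℝ} (hs : 0 ≤ s) (k m : ℕ) :
    (SimpleGraph.binomialRandom V p).real {G | ¬ IsTypical G p s k m}
      ≤ 2 * Fintype.card V * Real.exp (-2 * s ^ 2 / (Fintype.card V - 1))
        + 4 ^ Fintype.card V * Real.exp (-(p : ℝ) ^ 2 * (k * m) / 2) := by
  set n := Fintype.card V with hn
  set μ := SimpleGraph.binomialRandom V p
  let F : V → Finset (Sym2 V) := fun v => (⊤ : SimpleGraph V).incidenceFinset v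
  have hF : ∀ v, ∀ e ∈ F v, ¬ e.IsDiag := fun v e he =>
    SimpleGraph.not_isDiag_of_mem_edgeSet _ (((⊤ : SimpleGraph V).mem_incidenceFinset v e).1 he).1
  have hFc : ∀ v, (#(F v) : ℝ) = n - 1 := fun v => by
    have : 0 < n := Fintype.card_pos_iff.2 ⟨v⟩
    simp only [F, SimpleGraph.card_incidenceFinset_eq_degree, SimpleGraph.complete_graph_degree]
    rw [Nat.cast_pred this]
  let c : Finset (Finset V × Finset V) := {x | Disjoint x.1 x.2 ∧ #x.1 = k ∧ #x.2 = m}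
  let U : V → Set (SimpleGraph V) := fun v => {G | (p : ℝ) * ((n : ℝ) - 1) + s ≤ G.degree v}
  let L : V → Set (SimpleGraph V) := fun v => {G | (G.degree v : ℝ) ≤ p * ((n : ℝ) - 1) - s}
  let W : Finset V × Finset V → Set (SimpleGraph V) := fun x =>
    {G | ((∑ a ∈ x.1, #{b ∈ x.2 | G.Adj a b} : ℕ) : ℝ) ≤ p / 2 * (k * m)}
  have hsub : {G : SimpleGraph V | ¬ IsTypical G p s k m}
      ⊆ (⋃ v ∈ (univ : Finset V), U v) ∪ (⋃ v ∈ (univ : Finset V), L v) ∪ ⋃ x ∈ c, W x := by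
    intro G hG
    by_contra h
    refine hG ⟨fun v => ?_, fun v => ?_, fun A B h1 h2 h3 => ?_⟩ <;> by_contra! h'
    · exact h (.inl (.inl (Set.mem_biUnion (mem_coe.2 (mem_univ v)) h')))
    · exact h (.inl (.inr (Set.mem_biUnion (mem_coe.2 (mem_univ v)) h')))
    · exact h (.inr (Set.mem_biUnion (x := (A, B)) (by simp [c, h1, h2, h3]) h'))
  have hU : ∀ v, μ.real (U v) ≤ Real.exp (-2 * s ^ 2 / (n - 1)) := fun v => by
    have := binomialRandom_card_ge_le p (F v) (hF v) hs
    simp only [hFc] at this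
    simpa only [F, card_incidenceFinset_top_filter] using this
  have hL : ∀ v, μ.real (L v) ≤ Real.exp (-2 * s ^ 2 / (n - 1)) := fun v => by
    have := binomialRandom_card_le_le p (F v) (hF v) hs
    simp only [hFc] at this
    simpa only [F, card_incidenceFinset_top_filter] using this
  have hW : ∀ x ∈ c, μ.real (W x) ≤ Real.exp (-(p : ℝ) ^ 2 * (k * m) / 2) := by
    rintro ⟨A, B⟩ hx
    simp only [c, mem_filter, mem_univ, true_and] at hx
    obtain ⟨hd, hA, hB⟩ := hx
    have hdiag : ∀ e ∈ (A ×ˢ B).image (fun x : V × V => s(x.1, x.2)), ¬ e.IsDiag := by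
      simp only [mem_image, mem_product, Prod.exists]
      rintro _ ⟨a, b, ⟨ha, hb⟩, rfl⟩ h
      exact disjoint_left.1 hd ha ((Sym2.mk_isDiag_iff.1 h) ▸ hb)
    have hcard : (#((A ×ˢ B).image (fun x : V × V => s(x.1, x.2))) : ℝ) = k * m := by
      rw [card_image_of_injOn (injOn_mk_product hd), card_product, hA, hB]
      push_cast
      rfl
    have h := binomialRandom_card_le_le p _ hdiag (ε := p / 2 * (k * m))
      (by have := p.2.1; positivity)
    simp only [card_cut_filter _ hd, hcard] at h
    have h1 : (p : ℝ) * (k * m) - p / 2 * (k * m) = p / 2 * (k * m) := by ring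
    rw [h1] at h
    refine h.trans_eq ?_
    congr 1
    by_cases h0 : (k * m : ℝ) = 0
    · simp [h0]
    · rw [div_eq_div_iff h0 (by norm_num)]
      ring
  have hc : (#c : ℝ) ≤ 4 ^ n := by
    have h1 : #c ≤ Fintype.card (Finset V × Finset V) := card_le_univ c
    rw [Fintype.card_prod, Fintype.card_finset, ← mul_pow] at h1
    exact_mod_cast h1
  calc μ.real {G | ¬ IsTypical G p s k m}
      ≤ μ.real ((⋃ v ∈ (univ : Finset V), U v) ∪ (⋃ v ∈ (univ : Finset V), L v) ∪ ⋃ x ∈ c, W x) :=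
        measureReal_mono hsub
    _ ≤ μ.real (⋃ v ∈ (univ : Finset V), U v) + μ.real (⋃ v ∈ (univ : Finset V), L v)
        + μ.real (⋃ x ∈ c, W x) :=
        (measureReal_union_le _ _).trans (add_le_add_left (measureReal_union_le _ _) _)
    _ ≤ ∑ v, μ.real (U v) + ∑ v, μ.real (L v) + ∑ x ∈ c, μ.real (W x) := by
        gcongr <;> exact measureReal_biUnion_finset_le _ _
    _ ≤ ∑ _v : V, Real.exp (-2 * s ^ 2 / (n - 1)) + ∑ _v : V, Real.exp (-2 * s ^ 2 / (n - 1))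
        + ∑ x ∈ c, Real.exp (-(p : ℝ) ^ 2 * (k * m) / 2) :=
        add_le_add (add_le_add (sum_le_sum fun v _ => hU v) (sum_le_sum fun v _ => hL v))
          (sum_le_sum hW)
    _ = 2 * n * Real.exp (-2 * s ^ 2 / (n - 1))
        + #c * Real.exp (-(p : ℝ) ^ 2 * (k * m) / 2) := by
        simp only [sum_const, nsmul_eq_mul, card_univ, ← hn]
        ring
    _ ≤ _ := by gcongr

/-- Typical graphs have spanning regular subgraphs of the degree `regDegree 4 p n`. -/
theorem IsTypical.hasSpanningRegularSubgraph {n : ℕ} {G : SimpleGraph (Fin n)} {p s : ℝ}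
    (hp0 : 0 < p) (hp1 : p ≤ 1) (hsn : s = √(n * Real.log n)) (hs2 : 2 ≤ s)
    (hlarge : 330 * s ≤ p ^ 3 * n)
    (hG : IsTypical G p s ⌈s⌉₊ ⌈14 * s / p⌉₊) :
    HasSpanningRegularSubgraph G (regDegree 4 p n) := by
  obtain ⟨hup, hlo, hcut⟩ := hG
  rw [Fintype.card_fin] at hup hlo
  set k := ⌈s⌉₊
  set m := ⌈14 * s / p⌉₊
  set q := ⌈300 * s / p ^ 2⌉₊
  have hs0 : 0 < s := by linarith
  have hk1 : s ≤ k := Nat.le_ceil _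
  have hk2 : (k : ℝ) < s + 1 := Nat.ceil_lt_add_one hs0.le
  have hm1 : 14 * s / p ≤ m := Nat.le_ceil _
  have hm2 : (m : ℝ) < 14 * s / p + 1 := Nat.ceil_lt_add_one (by positivity)
  have hD1 : 6 * s ≤ ⌈6 * s⌉₊ := Nat.le_ceil _
  have hD2 : (⌈6 * s⌉₊ : ℝ) < 6 * s + 1 := Nat.ceil_lt_add_one (by positivity)
  have hq1 : 300 * s / p ^ 2 ≤ q := Nat.le_ceil _
  have hq2 : (q : ℝ) < 300 * s / p ^ 2 + 1 :=
    Nat.ceil_lt_add_one (by positivity)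
  have hp2 : p ^ 2 ≤ p := by nlinarith
  have hsp : s ≤ s / p := (le_div_iff₀ hp0).2 (by nlinarith)
  have hsp2 : s / p ≤ s / p ^ 2 := by gcongr
  have hlarge' : 330 * (s / p ^ 2) ≤ p * n := by
    rw [← mul_div_assoc, div_le_iff₀ (by positivity)]
    linarith
  have e14 : 14 * s / p = 14 * (s / p) := by ring
  have e300 : 300 * s / p ^ 2 = 300 * (s / p ^ 2) := by ring
  rw [e14] at hm1 hm2
  rw [e300] at hq1 hq2
  have hx : 0 ≤ p * n - 4 * √(n * Real.log n) := by rw [← hsn]; linarith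
  obtain ⟨⟨hd1, hev⟩, -⟩ := regDegree_isGreatest hx
  -- The floor loses less than one and the parity correction at most one more.
  have hd2 : p * n - 4 * s - 2 ≤ regDegree 4 p n := by
    rw [hsn]
    have h1 := Nat.lt_floor_add_one (p * n - 4 * √(n * Real.log n))
    unfold regDegree
    split_ifs
    · linarith
    · have h2 : ((⌊p * n - 4 * √(n * Real.log n)⌋₊ : ℕ) : ℝ)
          ≤ ((⌊p * n - 4 * √(n * Real.log n)⌋₊ - 1 : ℕ) : ℝ) + 1 := by
        norm_cast
        omega
      linarith
  rw [← hsn] at hd1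
  -- `D` covers the upper degree excess of about `5 s`, and `14` makes `p m / 2 ≥ 7 s` exceed `D`.
  -- `M = k + m` allows for removing `A` from `B`. Since `M ≤ 17 s / p`, the value of `q` beats `289
  -- s / p ^ 2`; `330` then covers `300 + 17 + 4` and rounding.
  refine hasSpanningRegularSubgraph_of_expansion G (r := k + 2) (D := ⌈6 * s⌉₊) (k := k)
    (M := k + m) (q := q) (by simpa using hev) (fun x => ?_) (fun x => ?_)
    ?_ le_rfl ?_ ?_ ?_
  · have := hlo x
    have h : ((regDegree 4 p n + (k + 2) : ℕ) : ℝ) ≤ G.degree x := by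
      push_cast
      linarith
    exact_mod_cast h
  · have := hup x
    have h : (G.degree x : ℝ) ≤ ((regDegree 4 p n + ⌈6 * s⌉₊ : ℕ) : ℝ) := by
      push_cast
      linarith
    exact_mod_cast h
  · intro A B hA hB
    have h1 : m ≤ #(B \ A) := by
      have : #B - #A ≤ #(B \ A) := le_card_sdiff A B
      omega
    obtain ⟨B', hB', hm⟩ := exists_subset_card_eq h1
    have h2 := hcut A B' (disjoint_sdiff.mono_right hB') hA hm
    have h3 : ∑ a ∈ A, #{b ∈ B' | G.Adj a b} ≤ ∑ a ∈ A, #{b ∈ B | G.Adj a b} :=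
      sum_le_sum fun a _ => card_le_card (filter_subset_filter _ (hB'.trans sdiff_subset))
    refine lt_of_lt_of_le ?_ h3
    have h4 : ((⌈6 * s⌉₊ * k : ℕ) : ℝ) < ((∑ a ∈ A, #{b ∈ B' | G.Adj a b} : ℕ) : ℝ) := by
      refine lt_of_le_of_lt ?_ h2
      push_cast
      have h5 : 7 * s ≤ p / 2 * m := by
        calc 7 * s = p / 2 * (14 * (s / p)) := by field_simp; norm_num
          _ ≤ _ := by gcongr
      have h6 : (⌈6 * s⌉₊ : ℝ) ≤ p / 2 * m := by linarith
      calc (⌈6 * s⌉₊ : ℝ) * k ≤ p / 2 * m * k := by gcongr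
        _ = _ := by ring
    exact_mod_cast h4
  · have h : (⌈6 * s⌉₊ : ℝ) ≤ ((k + m : ℕ) : ℝ) := by
      push_cast
      linarith
    exact_mod_cast h
  · have h1 : ((k + m : ℕ) : ℝ) ≤ 17 * (s / p) := by
      push_cast
      linarith
    have h : (((k + m) * (k + m) : ℕ) : ℝ) < ((q * (k + 2) : ℕ) : ℝ) := by
      calc (((k + m) * (k + m) : ℕ) : ℝ) = ((k + m : ℕ) : ℝ) * ((k + m : ℕ) : ℝ) := by push_cast; ring
        _ ≤ (17 * (s / p)) * (17 * (s / p)) := by gcongr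
        _ = 289 * (s / p ^ 2) * s := by field_simp; norm_num
        _ < 300 * (s / p ^ 2) * s := by gcongr; norm_num
        _ ≤ q * (k + 2) := by gcongr; linarith
        _ = _ := by push_cast; ring
    exact_mod_cast h
  · have h : ((q + 3 + (k + m) : ℕ) : ℝ) ≤ regDegree 4 p n := by
      push_cast
      linarith
    exact_mod_cast h

end RandomGraph

/-! ### Asymptotic estimates. -/

section Asymptotics

open Filter Topology Real

theorem eventually_two_le_sqrt_mul_log : ∀ᶠ n : ℕ in atTop, 2 ≤ √(n * log n) := by
  filter_upwards [eventually_ge_atTop 4] with n hn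
  have h4 : (4 : ℝ) ≤ n := by exact_mod_cast hn
  have hlog : 1 ≤ log n := by
    rw [le_log_iff_exp_le (by linarith)]
    linarith [exp_one_lt_d9]
  exact le_sqrt_of_sq_le (by nlinarith)

theorem eventually_sqrt_mul_log_le {c : ℝ} (hc : 0 < c) :
    ∀ᶠ n : ℕ in atTop, √(n * log n) ≤ c * n := by
  have h := (isLittleO_log_id_atTop.bound (sq_pos_of_pos hc)).natCast_atTop
  filter_upwards [h, eventually_ge_atTop 1] with n h hn
  have h1 : (1 : ℝ) ≤ n := by exact_mod_cast hn
  rw [norm_of_nonneg (log_nonneg h1), id, norm_of_nonneg (by linarith)] at h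
  rw [sqrt_le_left (by positivity)]
  nlinarith

/-- The degree term is at most `2 n · n ^ (-2)`. The cut exponent is at most `-7 p n log n`, which
eventually beats `4 ^ n` with a factor `exp (-n)` to spare. -/
theorem tendsto_atypical_bound {p : ℝ} (hp : 0 < p) :
    Tendsto (fun n : ℕ => 2 * (n : ℝ) * exp (-2 * √(n * log n) ^ 2 / (n - 1))
      + 4 ^ n * exp (-p ^ 2 * (⌈√(n * log n)⌉₊ * ⌈14 * √(n * log n) / p⌉₊) / 2)) atTop (𝓝 0) := by
  have hlim : Tendsto (fun n : ℕ => 2 / (n : ℝ) + exp (-n)) atTop (𝓝 0) := by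
    simpa using (tendsto_const_div_atTop_nhds_zero_nat 2).add
      (tendsto_exp_neg_atTop_nhds_zero.comp tendsto_natCast_atTop_atTop)
  have hlog := ((tendsto_log_atTop.comp tendsto_natCast_atTop_atTop).const_mul_atTop
    (show 0 < 7 * p by positivity)).eventually_ge_atTop (1 + log 4)
  refine squeeze_zero' (Eventually.of_forall fun n => by positivity) ?_ hlim
  filter_upwards [hlog, eventually_ge_atTop 2] with n hn hn2
  simp only [Function.comp] at hn
  have h2 : (2 : ℝ) ≤ n := by exact_mod_cast hn2
  have hn0 : (0 : ℝ) < n := by linarith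
  have hl0 : 0 ≤ log n := log_nonneg (by linarith)
  set s := √(n * log n) with hs
  have hs0 : 0 ≤ s := sqrt_nonneg _
  have hsq : s ^ 2 = n * log n := sq_sqrt (by positivity)
  refine add_le_add ?_ ?_
  · have h1 : -2 * s ^ 2 / (n - 1) ≤ log ((n : ℝ) ^ 2)⁻¹ := by
      rw [div_le_iff₀ (by linarith), log_inv, log_pow, hsq]
      push_cast
      nlinarith
    calc 2 * (n : ℝ) * exp (-2 * s ^ 2 / (n - 1)) ≤ 2 * n * exp (log ((n : ℝ) ^ 2)⁻¹) := by gcongr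
      _ = 2 / n := by
        rw [exp_log (by positivity)]
        field_simp
  · have h1 : s * (14 * s / p) ≤ ⌈s⌉₊ * ⌈14 * s / p⌉₊ := by
      gcongr <;> exact Nat.le_ceil _
    have h2 : p ^ 2 * (s * (14 * s / p)) = 14 * p * (n * log n) := by
      rw [← hsq]
      field_simp
    have h3 := mul_le_mul_of_nonneg_left h1 (sq_nonneg p)
    rw [h2] at h3
    have h4 : (4 : ℝ) ^ n = exp (n * log 4) := by
      rw [mul_comm, ← rpow_def_of_pos (by norm_num), rpow_natCast]
    rw [h4, ← exp_add, exp_le_exp]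
    have h5 := mul_le_mul_of_nonneg_left hn hn0.le
    nlinarith

end Asymptotics

theorem mainTheorem11 :
    ∃ C : ℝ, 0 < C ∧ ∀ p : unitInterval, 0 < p → p < 1 →
      Filter.Tendsto
        (fun n : ℕ => SimpleGraph.binomialRandom (Fin n) p
          {G : SimpleGraph (Fin n) | HasSpanningRegularSubgraph G (regDegree C (p : ℝ) n)})
        Filter.atTop (nhds 1) := by
  refine ⟨4, by norm_num, fun p hp0 _ => ?_⟩
  have hp : (0 : ℝ) < p := hp0
  have hlim := (ENNReal.tendsto_ofReal ((tendsto_atypical_bound hp).const_sub 1))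
  rw [sub_zero, ENNReal.ofReal_one] at hlim
  refine tendsto_of_tendsto_of_tendsto_of_le_of_le' hlim tendsto_const_nhds ?_
    (.of_forall fun n => MeasureTheory.prob_le_one)
  filter_upwards [eventually_two_le_sqrt_mul_log,
    eventually_sqrt_mul_log_le (show 0 < (p : ℝ) ^ 3 / 330 by positivity)] with n hs2 hsn
  set μ := SimpleGraph.binomialRandom (Fin n) p
  set T := {G : SimpleGraph (Fin n) | HasSpanningRegularSubgraph G (regDegree 4 (p : ℝ) n)}
  have hbad := binomialRandom_not_isTypical_le (V := Fin n) p (Real.sqrt_nonneg (n * Real.log n))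
    ⌈√(n * Real.log n)⌉₊ ⌈14 * √(n * Real.log n) / p⌉₊
  rw [Fintype.card_fin] at hbad
  have hsub : Tᶜ ⊆ {G | ¬ IsTypical G p √(n * Real.log n) ⌈√(n * Real.log n)⌉₊
      ⌈14 * √(n * Real.log n) / p⌉₊} := fun G hG hG' =>
    hG (hG'.hasSpanningRegularSubgraph hp p.2.2 rfl hs2 (by linarith))
  have hcompl := (MeasureTheory.measureReal_mono (μ := μ) hsub).trans hbad
  -- Subadditivity alone is enough here, so measurability of `T` is not needed.
  have htot : 1 ≤ μ.real T + μ.real Tᶜ := by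
    have h := MeasureTheory.measureReal_union_le (μ := μ) T Tᶜ
    rwa [Set.union_compl_self, MeasureTheory.probReal_univ] at h
  rw [← MeasureTheory.ofReal_measureReal (μ := μ) (s := T)]
  exact ENNReal.ofReal_le_ofReal (by linarith)
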